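/- Let $A$ be a unital $C^*$-algebra and let $V$ be a Hilbert $A$-module, i.e. an $A$-module with a positive definite $A$-valued inner product $\langle\cdot,\cdot\rangle$ that is $A$-linear in the second variable and satisfies $\langle x,y\rangle=\langle y,x\rangle^*$, such that $V$ is complete for the norm $\|x\|=\|\langle x,x\rangle\|^{1/2}$. (It does not matter on which side $A$ acts, since right $A$-modules are the same as left modules over the opposite $C^*$-algebra.) Suppose that $V$ is countably generated: there is a sequence in $V$ whose finite $A$-linear combinations are norm-dense in $V$. Let $V'$ be the set of all bounded $A$-linear maps $V\to A$. Let $\tau_{V'}$ be the topology on $V$ generated by the seminorms $x\mapsto\|f(x)\|$, $f\in V'$, and let $\tau_{\widehat V}$ be the topology on $V$ generated by the seminorms $x\mapsto\|\langle z,x\rangle\|$, $z\in V$. If $\tau_{\widehat V}=\tau_{V'}$, then $V$ is self-dual: for every $f\in V'$ there is $x\in V$ such that $f(y)=\langle x,y\rangle$ for all $y\in V$. -/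

import Mathlib

namespace HilbertCStar

section

variable (A V : Type*) [CStarAlgebra A] [PartialOrder A] [StarOrderedRing A]
  [NormedAddCommGroup V] [NormedSpace ℂ V] [Module A V] [CStarModule A V]

/-- The scalar `c` acts on a Hilbert module in the same way as the element `c • 1` of `A`. -/
theorem smul_one_smul_eq (c : ℂ) (x : V) : (c • (1 : A)) • x = c • x := by
  have h : ∀ z : V, inner A z ((c • (1 : A)) • x - c • x) = 0 := fun z => by
    simp [CStarModule.inner_sub_right]
  exact sub_eq_zero.1 (CStarModule.inner_self.1 (h _))

variable {A V} in
/-- A bounded `A`-linear map `f : V → A`, regarded as a complex linear map. -/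
def toComplexLinear (f : V →L[A] A) : V →ₗ[ℂ] A where
  toFun x := f x
  map_add' x y := map_add f x y
  map_smul' c x := by
    rw [← smul_one_smul_eq A V c x, map_smul]
    simp

/-- The seminorms `ν_f (x) = ‖f x‖` on `V`, indexed by the elements `f` of the dual module `V'`,
the module of all bounded `A`-linear maps `V → A`. -/
noncomputable def dualSeminorms : SeminormFamily ℂ V (V →L[A] A) :=
  fun f => (normSeminorm ℂ A).comp (toComplexLinear f)

/-- The seminorms `μ_z (x) = ‖⟨z, x⟩‖` on `V`, indexed by the elements `z` of `V`. -/
noncomputable def hatSeminorms : SeminormFamily ℂ V V :=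
  fun z => (normSeminorm ℂ A).comp (CStarModule.innerₛₗ (A := A) z)

/-- The `V'`-weak module topology on `V`: the locally convex topology generated by the seminorms
`ν_f`, `f ∈ V'`. -/
noncomputable def tauDual : TopologicalSpace V :=
  (dualSeminorms A V).moduleFilterBasis.topology

/-- The `V̂`-weak module topology on `V`: the locally convex topology generated by the seminorms
`μ_z`, `z ∈ V`. -/
noncomputable def tauHat : TopologicalSpace V :=
  (hatSeminorms A V).moduleFilterBasis.topology

variable {V} in
/-- The element `x^ = ⟨x, ·⟩` of the dual module `V'`. -/
noncomputable def hat (x : V) : V →L[A] A where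
  toFun y := inner A x y
  map_add' _ _ := CStarModule.inner_add_right
  map_smul' _ _ := CStarModule.inner_op_smul_right
  cont := (CStarModule.innerSL (A := A) x).continuous

/-- `V` is self-dual: every bounded `A`-linear map `V → A` is of the form `⟨x, ·⟩`, `x ∈ V`. -/
def IsSelfDual : Prop :=
  Function.Surjective (hat A : V → (V →L[A] A))

/-- `V` is countably generated: the finite `A`-linear combinations of some sequence in `V` are
dense in norm. -/
def IsCountablyGenerated : Prop :=
  ∃ x : ℕ → V, Dense (Submodule.span A (Set.range x) : Set V)

end

end HilbertCStar

/-!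
If `τ_V̂ = τ_{V'}`, a functional `f ∈ V'` is dominated by finitely many seminorms `μ_z`, `z ∈ s`,
hence by the quadratic form of the frame operator `T x = ∑ z ∈ s, ⟨z, x⟩ z`, and `f ∘ T` is
represented by an element of `V`. Scale `T` to a positive contraction `S`. The operator
`1 - (1 - S) ^ k` is a multiple of `S`, so `f - f ∘ (1 - S) ^ k` is represented too, while
`‖⟨y, S y⟩‖ ≤ ‖x‖ ^ 2 / k` for `y = (1 - S) ^ k x` makes `f ∘ (1 - S) ^ k` tend to zero in norm.
Since `x ↦ ⟨x, ·⟩` is isometric and `V` is complete, the limit `f` is represented as well.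
-/

namespace HilbertCStar

open Filter Topology
open scoped NNReal

section PosContraction

variable {A V : Type*} [NonUnitalRing A] [StarRing A] [Module ℂ A] [PartialOrder A] [Norm A]
  [AddCommGroup V] [Module ℂ V] [SMul A V] [Norm V] [CStarModule A V]

variable (A) in
/-- `S` is a positive contraction of the inner product module `V`: it is symmetric and
`0 ≤ ⟨x, S x⟩ ≤ ⟨x, x⟩` for all `x`. The iterates `y = (1 - S) ^ k x` then make the form `⟨y, S y⟩`
decay like `1 / k`. -/
structure IsPosContraction (S : Module.End ℂ V) : Prop where
  inner_map_left : ∀ x y, inner A (S x) y = inner A x (S y)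
  inner_map_self_nonneg : ∀ x, 0 ≤ inner A x (S x)
  inner_map_self_le : ∀ x, inner A x (S x) ≤ inner A x x

theorem inner_pow_left {T : Module.End ℂ V} (hT : ∀ x y, inner A (T x) y = inner A x (T y))
    (k : ℕ) (x y : V) : inner A ((T ^ k) x) y = inner A x ((T ^ k) y) := by
  induction k generalizing y with
  | zero => rfl
  | succ k ih =>
    rw [pow_succ', Module.End.mul_apply, hT, ih, ← Module.End.mul_apply, ← pow_succ, pow_succ']

namespace IsPosContraction

variable [StarModule ℂ A] [StarOrderedRing A] {S : Module.End ℂ V}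

theorem one_sub (hS : IsPosContraction A S) : IsPosContraction A (1 - S) where
  inner_map_left x y := by simp [hS.inner_map_left]
  inner_map_self_nonneg x := by simpa using hS.inner_map_self_le x
  inner_map_self_le x := by simpa using hS.inner_map_self_nonneg x

theorem inner_map_map_le (hS : IsPosContraction A S) (x : V) :
    inner A (S x) (S x) ≤ inner A x (S x) := by
  -- `S - S² = (1 - S) S (1 - S) + S (1 - S) S` is a sum of two positive operators.
  have hsum : inner A x (S x) - inner A (S x) (S x) =
      inner A ((1 - S) x) (S ((1 - S) x)) + inner A (S x) ((1 - S) (S x)) := by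
    simp only [LinearMap.sub_apply, Module.End.one_apply, map_sub, CStarModule.inner_sub_left,
      CStarModule.inner_sub_right, hS.inner_map_left]
    abel
  rw [← sub_nonneg, hsum]
  exact add_nonneg (hS.inner_map_self_nonneg _) (hS.one_sub.inner_map_self_nonneg _)

theorem inner_one_sub_add_inner_map_le (hS : IsPosContraction A S) (x : V) :
    inner A ((1 - S) x) ((1 - S) x) + inner A x (S x) ≤ inner A x x := by
  rw [← le_sub_iff_add_le]
  simpa using hS.one_sub.inner_map_map_le x

theorem inner_one_sub_map_le (hS : IsPosContraction A S) (x : V) :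
    inner A ((1 - S) x) (S ((1 - S) x)) ≤ inner A x (S x) := by
  -- `S - (1 - S) S (1 - S) = S² + S (1 - S) S`.
  have hsum : inner A x (S x) - inner A ((1 - S) x) (S ((1 - S) x)) =
      inner A (S x) (S x) + inner A (S x) ((1 - S) (S x)) := by
    simp only [LinearMap.sub_apply, Module.End.one_apply, map_sub, CStarModule.inner_sub_left,
      CStarModule.inner_sub_right, hS.inner_map_left]
    abel
  rw [← sub_nonneg, hsum]
  exact add_nonneg CStarModule.inner_self_nonneg (hS.one_sub.inner_map_self_nonneg _)

theorem inner_one_sub_pow_add_nsmul_le (hS : IsPosContraction A S) (k : ℕ) (x : V) :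
    inner A (((1 - S) ^ k) x) (((1 - S) ^ k) x) +
      k • inner A (((1 - S) ^ k) x) (S (((1 - S) ^ k) x)) ≤ inner A x x := by
  induction k with
  | zero => simp
  | succ k ih =>
    rw [pow_succ', Module.End.mul_apply]
    set y := ((1 - S) ^ k) x
    calc inner A ((1 - S) y) ((1 - S) y) + (k + 1) • inner A ((1 - S) y) (S ((1 - S) y))
        ≤ inner A ((1 - S) y) ((1 - S) y) + (k + 1) • inner A y (S y) := by
          gcongr
          exact hS.inner_one_sub_map_le y
      _ = inner A ((1 - S) y) ((1 - S) y) + inner A y (S y) + k • inner A y (S y) := by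
          rw [succ_nsmul', add_assoc]
      _ ≤ inner A y y + k • inner A y (S y) := by
          gcongr
          exact hS.inner_one_sub_add_inner_map_le y
      _ ≤ inner A x x := ih

theorem sub_apply_one_sub_pow_eq_inner (hS : IsPosContraction A S) {f : V →ₗ[ℂ] A} {u : V}
    (hu : ∀ x, f (S x) = inner A u x) (k : ℕ) (x : V) :
    f x - f (((1 - S) ^ k) x) = inner A (∑ j ∈ Finset.range k, ((1 - S) ^ j) u) x := by
  have hgeom : S (∑ j ∈ Finset.range k, ((1 - S) ^ j) x) = x - ((1 - S) ^ k) x := by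
    simpa using LinearMap.congr_fun (mul_neg_geom_sum (1 - S) k) x
  rw [← map_sub, ← hgeom, hu, CStarModule.inner_sum_right, CStarModule.inner_sum_left]
  exact Finset.sum_congr rfl fun j _ => (inner_pow_left hS.one_sub.inner_map_left j u x).symm

end IsPosContraction

end PosContraction

section Representable

variable {A V : Type*} [NonUnitalCStarAlgebra A] [PartialOrder A] [StarOrderedRing A]
  [NormedAddCommGroup V] [NormedSpace ℂ V] [SMul A V] [CStarModule A V]

theorem norm_innerSL (x : V) : ‖CStarModule.innerSL (A := A) x‖ = ‖x‖ := by
  refine ContinuousLinearMap.opNorm_eq_of_bounds (norm_nonneg x)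
    (fun _ => CStarModule.norm_inner_le V) fun M _ hM => ?_
  rcases (norm_nonneg x).eq_or_lt with hx | hx
  · rwa [← hx]
  · refine le_of_mul_le_mul_right ?_ hx
    calc ‖x‖ * ‖x‖ = ‖inner A x x‖ := by rw [← sq, CStarModule.norm_sq_eq A]
      _ ≤ M * ‖x‖ := hM x

theorem isClosed_range_innerSL [CompleteSpace V] :
    IsClosed (Set.range (CStarModule.innerSL : V →L⋆[ℂ] V →L[ℂ] A)) :=
  (AddMonoidHomClass.isometry_of_norm CStarModule.innerSL norm_innerSL)
    |>.isClosedEmbedding.isClosed_range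

namespace IsPosContraction

variable {S : Module.End ℂ V}

theorem sqrt_norm_inner_one_sub_pow_le (hS : IsPosContraction A S) {k : ℕ} (hk : 0 < k) (x : V) :
    √‖inner A (((1 - S) ^ k) x) (S (((1 - S) ^ k) x))‖ ≤ ‖x‖ / √k := by
  rw [← Real.sqrt_sq (norm_nonneg x), ← Real.sqrt_div (sq_nonneg _)]
  refine Real.sqrt_le_sqrt ((le_div_iff₀' (by positivity)).2 ?_)
  rw [CStarModule.norm_sq_eq A, ← nsmul_eq_mul, ← RCLike.norm_nsmul ℂ]
  exact CStarAlgebra.norm_le_norm_of_nonneg_of_le (nsmul_nonneg (hS.inner_map_self_nonneg _) k)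
    ((le_add_of_nonneg_left CStarModule.inner_self_nonneg).trans
      (hS.inner_one_sub_pow_add_nsmul_le k x))

theorem mem_range_innerSL [CompleteSpace V] (hS : IsPosContraction A S) {f : V →L[ℂ] A} {u : V}
    (hu : ∀ x, f (S x) = inner A u x) {C : ℝ} (hC : 0 ≤ C)
    (hf : ∀ x, ‖f x‖ ≤ C * √‖inner A x (S x)‖) :
    f ∈ Set.range (CStarModule.innerSL : V →L⋆[ℂ] V →L[ℂ] A) := by
  set v : ℕ → V := fun k => ∑ j ∈ Finset.range k, ((1 - S) ^ j) u
  have hdist {k : ℕ} (hk : 0 < k) : ‖CStarModule.innerSL (v k) - f‖ ≤ C / √k := by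
    rw [norm_sub_rev]
    refine ContinuousLinearMap.opNorm_le_bound _ (by positivity) fun x => ?_
    calc ‖f x - inner A (v k) x‖ = ‖f (((1 - S) ^ k) x)‖ := by
          rw [← hS.sub_apply_one_sub_pow_eq_inner (f := f.toLinearMap) hu]
          simp
      _ ≤ C * √‖inner A (((1 - S) ^ k) x) (S (((1 - S) ^ k) x))‖ := hf _
      _ ≤ C * (‖x‖ / √k) := by
          gcongr
          exact hS.sqrt_norm_inner_one_sub_pow_le hk x
      _ = C / √k * ‖x‖ := by ring
  have hlim : Tendsto (fun k => CStarModule.innerSL (v k)) atTop (𝓝 f) := by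
    refine tendsto_iff_norm_sub_tendsto_zero.2 (squeeze_zero' (.of_forall fun _ => norm_nonneg _)
      ((eventually_gt_atTop 0).mono fun _ => hdist) ?_)
    exact (Real.tendsto_sqrt_atTop.comp tendsto_natCast_atTop_atTop).const_div_atTop _
  exact isClosed_range_innerSL.mem_of_tendsto hlim (.of_forall fun k => ⟨v k, rfl⟩)

end IsPosContraction

end Representable

section HilbertModule

variable {A V : Type*} [CStarAlgebra A] [PartialOrder A] [StarOrderedRing A]
  [NormedAddCommGroup V] [NormedSpace ℂ V] [Module A V] [CStarModule A V]

variable (A V) in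
theorem isScalarTower : IsScalarTower ℂ A V :=
  .of_algebraMap_smul fun c x => by rw [Algebra.algebraMap_eq_smul_one, smul_one_smul_eq]

variable (A) in
/-- The frame operator `x ↦ ∑ z ∈ s, ⟨z, x⟩ z` of a finite set `s`. Its quadratic form
`∑ z ∈ s, ⟨z, x⟩ ⟨z, x⟩*` dominates the squares of the seminorms `μ_z`, `z ∈ s`. -/
noncomputable def frameOperator (s : Finset V) : Module.End ℂ V where
  toFun x := ∑ z ∈ s, inner A z x • z
  map_add' x y := by simp only [CStarModule.inner_add_right, add_smul, Finset.sum_add_distrib]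
  map_smul' c x := by
    have := isScalarTower A V
    simp only [CStarModule.inner_smul_right_complex, smul_assoc, Finset.smul_sum, RingHom.id_apply]

theorem frameOperator_apply (s : Finset V) (x : V) :
    frameOperator A s x = ∑ z ∈ s, inner A z x • z := rfl

theorem inner_frameOperator_right (s : Finset V) (x y : V) :
    inner A x (frameOperator A s y) = ∑ z ∈ s, inner A z y * inner A x z := by
  simp only [frameOperator_apply, CStarModule.inner_sum_right, CStarModule.inner_op_smul_right]

theorem inner_frameOperator_left (s : Finset V) (x y : V) :
    inner A (frameOperator A s x) y = inner A x (frameOperator A s y) := by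
  simp only [frameOperator_apply, CStarModule.inner_sum_left, CStarModule.inner_sum_right,
    CStarModule.inner_op_smul_left, CStarModule.inner_op_smul_right, CStarModule.star_inner]

theorem inner_frameOperator_self (s : Finset V) (x : V) :
    inner A x (frameOperator A s x) = ∑ z ∈ s, inner A z x * star (inner A z x) := by
  simp only [inner_frameOperator_right, CStarModule.star_inner]

theorem inner_frameOperator_self_nonneg (s : Finset V) (x : V) :
    0 ≤ inner A x (frameOperator A s x) := by
  rw [inner_frameOperator_self]
  exact Finset.sum_nonneg fun z _ => mul_star_self_nonneg _

theorem inner_frameOperator_self_le (s : Finset V) (x : V) :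
    inner A x (frameOperator A s x) ≤ (∑ z ∈ s, ‖z‖ ^ 2) • inner A x x := by
  rw [inner_frameOperator_right, Finset.sum_smul]
  exact Finset.sum_le_sum fun z _ => CStarModule.inner_mul_inner_swap_le

theorem isPosContraction_smul_frameOperator (s : Finset V) {c : ℝ} (hc : 0 ≤ c)
    (hcs : c * ∑ z ∈ s, ‖z‖ ^ 2 ≤ 1) : IsPosContraction A ((c : ℂ) • frameOperator A s) where
  inner_map_left x y := by simp [inner_frameOperator_left]
  inner_map_self_nonneg x := by
    simpa using smul_nonneg hc (inner_frameOperator_self_nonneg s x)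
  inner_map_self_le x := by
    calc inner A x (((c : ℂ) • frameOperator A s) x) = c • inner A x (frameOperator A s x) := by
          simp
      _ ≤ c • (∑ z ∈ s, ‖z‖ ^ 2) • inner A x x := by
          gcongr
          exact inner_frameOperator_self_le s x
      _ ≤ (1 : ℝ) • inner A x x := by
          rw [smul_smul]
          exact smul_le_smul_of_nonneg_right hcs CStarModule.inner_self_nonneg
      _ = inner A x x := one_smul _ _

theorem exists_pos_isPosContraction_smul_frameOperator (s : Finset V) :
    ∃ c : ℝ, 0 < c ∧ IsPosContraction A ((c : ℂ) • frameOperator A s) := by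
  refine ⟨(1 + ∑ z ∈ s, ‖z‖ ^ 2)⁻¹, by positivity,
    isPosContraction_smul_frameOperator s (by positivity) ?_⟩
  rw [inv_mul_le_one₀ (by positivity)]
  linarith

theorem map_frameOperator (f : V →L[A] A) (s : Finset V) (x : V) :
    f (frameOperator A s x) = inner A (∑ z ∈ s, star (f z) • z) x := by
  simp [frameOperator_apply]

theorem sup_hatSeminorms_le_sqrt (s : Finset V) (x : V) :
    s.sup (hatSeminorms A V) x ≤ √‖inner A x (frameOperator A s x)‖ := by
  refine Seminorm.finset_sup_apply_le (Real.sqrt_nonneg _) fun z hz => Real.le_sqrt_of_sq_le ?_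
  calc ‖inner A z x‖ ^ 2 = ‖inner A z x * star (inner A z x)‖ := by
        rw [CStarRing.norm_self_mul_star, sq]
    _ ≤ ‖inner A x (frameOperator A s x)‖ := by
        rw [inner_frameOperator_self]
        exact CStarAlgebra.norm_le_norm_of_nonneg_of_le (mul_star_self_nonneg _)
          (Finset.single_le_sum (f := fun z => inner A z x * star (inner A z x))
            (fun z _ => mul_star_self_nonneg _) hz)

theorem mem_range_hat_of_le_sup_hatSeminorms [CompleteSpace V] {f : V →L[A] A} {s : Finset V}
    {C : ℝ≥0} (hf : dualSeminorms A V f ≤ C • s.sup (hatSeminorms A V)) :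
    f ∈ Set.range (hat A) := by
  obtain ⟨c, hc, hS⟩ := exists_pos_isPosContraction_smul_frameOperator (A := A) s
  set S : Module.End ℂ V := (c : ℂ) • frameOperator A s with hS_def
  have hrep (x : V) : f (S x) = inner A ((c : ℂ) • ∑ z ∈ s, star (f z) • z) x := by
    calc f (S x) = (c : ℂ) • f (frameOperator A s x) := (toComplexLinear f).map_smul _ _
      _ = inner A ((c : ℂ) • ∑ z ∈ s, star (f z) • z) x := by
          rw [map_frameOperator, CStarModule.inner_smul_left_complex, RCLike.star_def,
            Complex.conj_ofReal]
  have hnorm (x : V) : ‖inner A x (frameOperator A s x)‖ = c⁻¹ * ‖inner A x (S x)‖ := by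
    rw [hS_def, LinearMap.smul_apply, CStarModule.inner_smul_right_complex, norm_smul,
      Complex.norm_of_nonneg hc.le, inv_mul_cancel_left₀ hc.ne']
  have hbound (x : V) : ‖f x‖ ≤ C * √c⁻¹ * √‖inner A x (S x)‖ := by
    calc ‖f x‖ ≤ C * s.sup (hatSeminorms A V) x := hf x
      _ ≤ C * √‖inner A x (frameOperator A s x)‖ := by
          gcongr
          exact sup_hatSeminorms_le_sqrt s x
      _ = C * √c⁻¹ * √‖inner A x (S x)‖ := by
          rw [hnorm, Real.sqrt_mul (inv_nonneg.2 hc.le), mul_assoc]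
  obtain ⟨v, hv⟩ := hS.mem_range_innerSL (f := ⟨toComplexLinear f, f.continuous⟩) hrep
    (by positivity) hbound
  exact ⟨v, ContinuousLinearMap.ext fun x => DFunLike.congr_fun hv x⟩

theorem exists_dualSeminorms_le_sup_hatSeminorms (htop : tauHat A V = tauDual A V)
    (f : V →L[A] A) :
    ∃ (s : Finset V) (C : ℝ≥0), dualSeminorms A V f ≤ C • s.sup (hatSeminorms A V) := by
  let := tauHat A V
  have hhat : WithSeminorms (hatSeminorms A V) := ⟨rfl⟩
  have hdual : WithSeminorms (dualSeminorms A V) := ⟨htop⟩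
  obtain ⟨s, C, -, hC⟩ := Seminorm.bound_of_continuous hhat _ (hdual.continuous_seminorm f)
  exact ⟨s, C, hC⟩

end HilbertModule

end HilbertCStar

theorem mainTheorem6_general (A V : Type*) [CStarAlgebra A] [PartialOrder A] [StarOrderedRing A]
    [NormedAddCommGroup V] [NormedSpace ℂ V] [Module A V] [CStarModule A V] [CompleteSpace V]
    (htop : HilbertCStar.tauHat A V = HilbertCStar.tauDual A V) :
    HilbertCStar.IsSelfDual A V := by
  intro f
  obtain ⟨s, C, hf⟩ := HilbertCStar.exists_dualSeminorms_le_sup_hatSeminorms htop f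
  exact HilbertCStar.mem_range_hat_of_le_sup_hatSeminorms hf

theorem mainTheorem6 (A V : Type*) [CStarAlgebra A] [PartialOrder A] [StarOrderedRing A]
    [NormedAddCommGroup V] [NormedSpace ℂ V] [Module A V] [CStarModule A V] [CompleteSpace V]
    (hgen : HilbertCStar.IsCountablyGenerated A V)
    (htop : HilbertCStar.tauHat A V = HilbertCStar.tauDual A V) :
    HilbertCStar.IsSelfDual A V :=
  mainTheorem6_general A V htop
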